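/- Let $\Bbbk$ be an algebraically closed field of characteristic $0$ and let $(F,G,\triangleright,\triangleleft)$ be a matched pair of finite groups, i.e. $\triangleright: G\times F\to F$ is a left action of $G$ on the set $F$, $\triangleleft: G\times F\to G$ is a right action of $F$ on the set $G$, and for all $a,b\in F$, $x,y\in G$ $$x\triangleright(ab)=(x\triangleright a)\bigl((x\triangleleft a)\triangleright b\bigr),\qquad (xy)\triangleleft a=\bigl(x\triangleleft(y\triangleright a)\bigr)(y\triangleleft a).$$ Let $H=\Bbbk^G\#\Bbbk F$ be the bismash product: the Hopf algebra with basis $p_x\#a$ ($x\in G$, $a\in F$), multiplication $(p_x\#a)(p_y\#b)=\delta_{x\triangleleft a,\,y}\;p_x\#ab$, unit $\sum_{x\in G}p_x\#1$, comultiplication $\Delta(p_x\#a)=\sum_{y\in G}\bigl(p_{xy^{-1}}\#(y\triangleright a)\bigr)\otimes(p_y\#a)$, counit $\varepsilon(p_x\#a)=\delta_{x,1}$ and antipode $S(p_x\#a)=p_{(x\triangleleft a)^{-1}}\#(x\triangleright a)^{-1}$. The Frobenius–Schur indicator of an $H$-module $W$ with character $\chi_W$ is $\nu_2(W)=\chi_W\bigl(\sum\Lambda_1\Lambda_2\bigr)$,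 where $\Lambda\in H$ is the integral with $\varepsilon(\Lambda)=1$ and $\Delta(\Lambda)=\sum \Lambda_1\otimes\Lambda_2$. For $x\in G$ let $\mathcal O_x=\{x\triangleleft a: a\in F\}$ and $F_x=\{a\in F: x\triangleleft a=x\}$. For a simple $\Bbbk F_x$-module $V$, the induced module $\widehat V=\Bbbk F\otimes_{\Bbbk F_x}V$ is an $H$-module via $(p_y\#a)(b\otimes v)=\delta_{y\triangleleft(ab),\,x}\,(ab\otimes v)$. The orbit $\mathcal O_x$ is called a null indicator orbit if $\nu_2(\widehat V)=0$ for every simple $\Bbbk F_x$-module $V$. Then for every $x\in G$ the following are equivalent: 1. $\mathcal O_x$ is a null indicator orbit; 2. $x^{-1}\notin\mathcal O_x$; 3. $y^{-1}\notin\mathcal O_x$ for some $y\in\mathcal O_x$; 4. $y^{-1}\notin\mathcal O_x$ for every $y\in\mathcal O_x$. -/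

import Mathlib

open scoped TensorProduct MonoidAlgebra

universe u v w

/-- A matched pair of groups `(F, G, ▷, ◁)`: a left action `▷ : G × F → F` of `G` on the set `F`,
written `M.actF x a = x ▷ a`, and a right action `◁ : G × F → G` of `F` on the set `G`, written
`M.actG x a = x ◁ a`, subject to the two compatibility conditions. -/
structure MatchedPair (F : Type v) (G : Type w) [Group F] [Group G] where
  /-- `x ▷ a` -/
  actF : G → F → F
  /-- `x ◁ a` -/
  actG : G → F → G
  actF_one : ∀ a : F, actF 1 a = a
  actF_mul : ∀ (x y : G) (a : F), actF (x * y) a = actF x (actF y a)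
  actG_one : ∀ x : G, actG x 1 = x
  actG_mul : ∀ (x : G) (a b : F), actG x (a * b) = actG (actG x a) b
  map_mul_F : ∀ (x : G) (a b : F), actF x (a * b) = actF x a * actF (actG x a) b
  map_mul_G : ∀ (x y : G) (a : F), actG (x * y) a = actG x (actF y a) * actG y a

namespace MatchedPair

variable {F : Type v} {G : Type w} [Group F] [Group G] (M : MatchedPair F G)

theorem actF_one_right (x : G) : M.actF x 1 = 1 := by
  have h := M.map_mul_F x 1 1
  rw [mul_one, M.actG_one] at h
  exact left_eq_mul.mp h

theorem actG_one_left (a : F) : M.actG 1 a = 1 := by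
  have h := M.map_mul_G 1 1 a
  rw [mul_one, M.actF_one] at h
  exact left_eq_mul.mp h

theorem actG_actG_inv (x : G) (a : F) : M.actG (M.actG x a) a⁻¹ = x := by
  rw [← M.actG_mul, mul_inv_cancel, M.actG_one]

theorem actG_inv_actG (x : G) (a : F) : M.actG (M.actG x a⁻¹) a = x := by
  rw [← M.actG_mul, inv_mul_cancel, M.actG_one]

theorem eq_actG_inv_iff (x y : G) (a : F) : x = M.actG y a⁻¹ ↔ M.actG x a = y := by
  constructor
  · rintro rfl; exact M.actG_inv_actG y a
  · rintro rfl; exact (M.actG_actG_inv x a).symm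

theorem actG_injective (a : F) : Function.Injective fun x => M.actG x a := fun x y h => by
  have := congrArg (fun z => M.actG z a⁻¹) h
  simpa only [M.actG_actG_inv] using this

theorem actG_mul_inv (x y : G) (a : F) :
    M.actG (x * y⁻¹) (M.actF y a) = M.actG x a * (M.actG y a)⁻¹ := by
  have h := M.map_mul_G (x * y⁻¹) y a
  rw [inv_mul_cancel_right] at h
  rw [h, mul_inv_cancel_right]

theorem actF_mul_inv (x y : G) (a : F) :
    M.actF (x * y⁻¹) (M.actF y a) = M.actF x a := by
  rw [← M.actF_mul, inv_mul_cancel_right]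

/-- The `F`-orbit `O_x = {x ◁ a : a ∈ F}` of `x ∈ G`. -/
def orbit (x : G) : Set G := Set.range fun a : F => M.actG x a

/-- The stabilizer `F_x = {a ∈ F : x ◁ a = x}` of `x ∈ G`. -/
def stabilizer (x : G) : Subgroup F where
  carrier := {a | M.actG x a = x}
  one_mem' := M.actG_one x
  mul_mem' := fun {a b} (ha : M.actG x a = x) (hb : M.actG x b = x) => by
    change M.actG x (a * b) = x
    rw [M.actG_mul, ha, hb]
  inv_mem' := fun {a} (ha : M.actG x a = x) => by
    change M.actG x a⁻¹ = x
    exact ((M.eq_actG_inv_iff x x a).2 ha).symm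

end MatchedPair

/-- The underlying space of the bismash product `H = k^G # kF`: the `k`-vector space with basis
`p_x # a`, `x ∈ G`, `a ∈ F`. -/
def Bismash (k : Type u) [Field k] {F : Type v} {G : Type w} [Group F] [Group G]
    (_M : MatchedPair F G) : Type (max u v w) := (G × F) →₀ k

namespace Bismash

variable (k : Type u) [Field k] {F : Type v} {G : Type w} [Group F] [Group G]
  (M : MatchedPair F G)

noncomputable instance : AddCommGroup (Bismash k M) :=
  inferInstanceAs (AddCommGroup ((G × F) →₀ k))

noncomputable instance : Module k (Bismash k M) :=
  inferInstanceAs (Module k ((G × F) →₀ k))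

/-- The basis `p_x # a`, indexed by the pairs `(x, a)`. -/
noncomputable def basis : Module.Basis (G × F) k (Bismash k M) :=
  ⟨LinearEquiv.refl k ((G × F) →₀ k)⟩

/-- The basis element `p_x # a`. -/
noncomputable def pa (x : G) (a : F) : Bismash k M := basis k M (x, a)

variable {k M} in
theorem hom_ext {W : Type*} [AddCommMonoid W] [Module k W] {f g : Bismash k M →ₗ[k] W}
    (h : ∀ x a, f (pa k M x a) = g (pa k M x a)) : f = g :=
  (basis k M).ext fun p => h p.1 p.2

/-- The linear map with prescribed values on the basis `p_x # a`. -/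
noncomputable def lift {W : Type*} [AddCommMonoid W] [Module k W] (f : G → F → W) :
    Bismash k M →ₗ[k] W :=
  (basis k M).constr k fun p => f p.1 p.2

@[simp]
theorem lift_pa {W : Type*} [AddCommMonoid W] [Module k W] (f : G → F → W) (x : G) (a : F) :
    lift k M f (pa k M x a) = f x a :=
  (basis k M).constr_basis k _ (x, a)

open Classical in
/-- The multiplication, as a bilinear map:
`(p_x # a)(p_y # b) = p_x (a ⇀ p_y) # ab` with `a ⇀ p_y = p_{y ◁ a⁻¹}`. -/
noncomputable def mulMap : Bismash k M →ₗ[k] Bismash k M →ₗ[k] Bismash k M :=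
  lift k M fun x a => lift k M fun y b =>
    if x = M.actG y a⁻¹ then pa k M x (a * b) else 0

noncomputable instance : Mul (Bismash k M) := ⟨fun f g => mulMap k M f g⟩

theorem mul_def (f g : Bismash k M) : f * g = mulMap k M f g := rfl

open Classical in
theorem pa_mul_pa (x y : G) (a b : F) :
    pa k M x a * pa k M y b = if M.actG x a = y then pa k M x (a * b) else 0 := by
  rw [mul_def, mulMap, lift_pa, lift_pa]
  simp only [M.eq_actG_inv_iff]

protected theorem mul_assoc' (f g h : Bismash k M) : f * g * h = f * (g * h) := by
  classical
  have key : (mulMap k M).compr₂ (mulMap k M)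
      = ((LinearMap.llcomp k _ _ _).flip (mulMap k M)).comp
        ((LinearMap.llcomp k (Bismash k M) (Bismash k M) (Bismash k M)).comp (mulMap k M)) := by
    refine hom_ext fun x a => hom_ext fun y b => hom_ext fun z c => ?_
    change pa k M x a * pa k M y b * pa k M z c = pa k M x a * (pa k M y b * pa k M z c)
    rw [pa_mul_pa, pa_mul_pa]
    by_cases h1 : M.actG x a = y
    · subst h1
      rw [if_pos rfl, pa_mul_pa, M.actG_mul]
      split_ifs with h2
      · rw [pa_mul_pa, if_pos rfl, mul_assoc]
      · exact (map_zero (mulMap k M (pa k M x a))).symm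
    · rw [if_neg h1]
      have h0 : (0 : Bismash k M) * pa k M z c = 0 := by rw [mul_def]; simp
      rw [h0]
      split_ifs with h2
      · rw [pa_mul_pa, if_neg h1]
      · exact (map_zero (mulMap k M (pa k M x a))).symm
  exact congrArg (fun T => T f g h) key

variable [Fintype G]

/-- The unit `∑ x, p_x # 1`. -/
noncomputable instance : One (Bismash k M) := ⟨∑ x : G, pa k M x 1⟩

theorem one_def : (1 : Bismash k M) = ∑ x : G, pa k M x 1 := rfl

protected theorem one_mul' (f : Bismash k M) : 1 * f = f := by
  classical
  have key : mulMap k M 1 = LinearMap.id := by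
    refine hom_ext fun y b => ?_
    rw [one_def, map_sum, LinearMap.sum_apply]
    simp only [← mul_def, pa_mul_pa, M.actG_one, one_mul]
    simp
  exact congrArg (fun T => T f) key

protected theorem mul_one' (f : Bismash k M) : f * 1 = f := by
  classical
  have key : (mulMap k M).flip 1 = LinearMap.id := by
    refine hom_ext fun y b => ?_
    rw [LinearMap.flip_apply, one_def, map_sum]
    simp only [← mul_def, pa_mul_pa, mul_one]
    simp
  exact congrArg (fun T => T f) key

noncomputable instance : Ring (Bismash k M) :=
  { (inferInstance : AddCommGroup (Bismash k M)),
    (inferInstance : Mul (Bismash k M)),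
    (inferInstance : One (Bismash k M)) with
    left_distrib := fun a b c => map_add (mulMap k M a) b c
    right_distrib := fun a b c => by
      change mulMap k M (a + b) c = mulMap k M a c + mulMap k M b c
      rw [map_add, LinearMap.add_apply]
    zero_mul := fun a => by change mulMap k M 0 a = 0; rw [map_zero, LinearMap.zero_apply]
    mul_zero := fun a => map_zero (mulMap k M a)
    mul_assoc := Bismash.mul_assoc' k M
    one_mul := Bismash.one_mul' k M
    mul_one := Bismash.mul_one' k M }

noncomputable instance : Algebra k (Bismash k M) :=
  Algebra.ofModule
    (fun r f g => by
      change mulMap k M (r • f) g = r • mulMap k M f g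
      rw [map_smul, LinearMap.smul_apply])
    (fun r f g => map_smul (mulMap k M f) r g)

/-- The comultiplication `Δ(p_x # a) = ∑ y, (p_{x y⁻¹} # (y ▷ a)) ⊗ (p_y # a)`. -/
noncomputable def comulMap : Bismash k M →ₗ[k] Bismash k M ⊗[k] Bismash k M :=
  lift k M fun x a => ∑ y : G, pa k M (x * y⁻¹) (M.actF y a) ⊗ₜ[k] pa k M y a

open Classical in
/-- The counit `ε(p_x # a) = δ_{x,1}`. -/
noncomputable def counitMap : Bismash k M →ₗ[k] k :=
  lift k M fun x _ => if x = 1 then 1 else 0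

noncomputable instance : CoalgebraStruct k (Bismash k M) where
  comul := comulMap k M
  counit := counitMap k M

theorem comul_pa (x : G) (a : F) :
    Coalgebra.comul (R := k) (pa k M x a) =
      ∑ y : G, pa k M (x * y⁻¹) (M.actF y a) ⊗ₜ[k] pa k M y a := by
  change comulMap k M _ = _
  rw [comulMap, lift_pa]

open Classical in
theorem counit_pa (x : G) (a : F) :
    Coalgebra.counit (R := k) (pa k M x a) = if x = 1 then 1 else 0 := by
  change counitMap k M _ = _
  rw [counitMap, lift_pa]

noncomputable instance : Coalgebra k (Bismash k M) where
  coassoc := by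
    refine hom_ext fun x a => ?_
    simp only [LinearMap.comp_apply, LinearEquiv.coe_coe, comul_pa, map_sum,
      LinearMap.rTensor_tmul, LinearMap.lTensor_tmul, TensorProduct.sum_tmul,
      TensorProduct.tmul_sum, TensorProduct.assoc_tmul]
    conv_rhs => rw [Finset.sum_comm]
    refine Finset.sum_congr rfl fun y _ => ?_
    refine Fintype.sum_equiv (Equiv.mulRight y) _ _ fun z => ?_
    simp only [Equiv.coe_mulRight, mul_inv_cancel_right, M.actF_mul, mul_inv_rev, ← mul_assoc]
  rTensor_counit_comp_comul := by
    classical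
    refine hom_ext fun x a => ?_
    simp only [LinearMap.comp_apply, comul_pa, map_sum, LinearMap.rTensor_tmul, counit_pa]
    rw [Finset.sum_eq_single x]
    · simp
    · intro y _ hy
      rw [if_neg (fun h => hy (mul_inv_eq_one.mp h).symm), TensorProduct.zero_tmul]
    · simp
  lTensor_counit_comp_comul := by
    classical
    refine hom_ext fun x a => ?_
    simp only [LinearMap.comp_apply, comul_pa, map_sum, LinearMap.lTensor_tmul, counit_pa]
    rw [Finset.sum_eq_single 1]
    · simp [M.actF_one]
    · intro y _ hy
      rw [if_neg hy, TensorProduct.tmul_zero]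
    · simp

theorem comul_one' : Coalgebra.comul (R := k) (1 : Bismash k M) = 1 := by
  rw [one_def, map_sum, Algebra.TensorProduct.one_def, one_def]
  simp only [comul_pa, M.actF_one_right, TensorProduct.sum_tmul, TensorProduct.tmul_sum]
  rw [Finset.sum_comm]
  refine Finset.sum_congr rfl fun y _ => ?_
  refine Fintype.sum_equiv (Equiv.mulRight y⁻¹) _ _ fun x => ?_
  rw [Equiv.coe_mulRight]

theorem counit_one' : Coalgebra.counit (R := k) (1 : Bismash k M) = 1 := by
  classical
  rw [one_def, map_sum]
  simp only [counit_pa]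
  simp

theorem counit_pa_mul_pa (x y : G) (a b : F) :
    Coalgebra.counit (R := k) (pa k M x a * pa k M y b) =
      Coalgebra.counit (R := k) (pa k M x a) * Coalgebra.counit (R := k) (pa k M y b) := by
  classical
  rw [pa_mul_pa, counit_pa, counit_pa]
  by_cases hx : x = 1
  · subst hx
    rw [M.actG_one_left]
    by_cases hy : y = 1
    · simp [hy, counit_pa]
    · rw [if_neg (Ne.symm hy), map_zero, if_neg hy, mul_zero]
  · rw [if_neg hx, zero_mul]
    split_ifs
    · rw [counit_pa, if_neg hx]
    · exact map_zero _

theorem comul_pa_mul_pa (x y : G) (a b : F) :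
    Coalgebra.comul (R := k) (pa k M x a * pa k M y b) =
      Coalgebra.comul (R := k) (pa k M x a) * Coalgebra.comul (R := k) (pa k M y b) := by
  classical
  have hR : Coalgebra.comul (R := k) (pa k M x a) * Coalgebra.comul (R := k) (pa k M y b) =
      ∑ u : G, if M.actG x a = y then
        pa k M (x * u⁻¹) (M.actF u (a * b)) ⊗ₜ[k] pa k M u (a * b) else 0 := by
    rw [comul_pa, comul_pa, Finset.sum_mul]
    refine Finset.sum_congr rfl fun u _ => ?_
    rw [Finset.mul_sum, Finset.sum_eq_single (M.actG u a)]
    · rw [Algebra.TensorProduct.tmul_mul_tmul, pa_mul_pa, pa_mul_pa, if_pos rfl, M.actG_mul_inv,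
        M.map_mul_F]
      by_cases h : M.actG x a = y
      · rw [if_pos h, if_pos (by rw [h])]
      · rw [if_neg h, if_neg (fun h' => h (mul_right_cancel h')), TensorProduct.zero_tmul]
    · intro v _ hv
      rw [Algebra.TensorProduct.tmul_mul_tmul, pa_mul_pa k M u v, if_neg (Ne.symm hv),
        TensorProduct.tmul_zero]
    · simp
  rw [hR, pa_mul_pa]
  split_ifs with h
  · exact comul_pa k M x (a * b)
  · rw [map_zero, Finset.sum_const_zero]

noncomputable instance : Bialgebra k (Bismash k M) where
  counit_one := counit_one' k M
  mul_compr₂_counit := hom_ext fun x a => hom_ext fun y b => counit_pa_mul_pa k M x y a b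
  comul_one := comul_one' k M
  mul_compr₂_comul := hom_ext fun x a => hom_ext fun y b => comul_pa_mul_pa k M x y a b

/-- The antipode `S(p_x # a) = p_{(x ◁ a)⁻¹} # (x ▷ a)⁻¹`. -/
noncomputable def antipodeMap : Bismash k M →ₗ[k] Bismash k M :=
  lift k M fun x a => pa k M (M.actG x a)⁻¹ (M.actF x a)⁻¹

theorem antipodeMap_pa (x : G) (a : F) :
    antipodeMap k M (pa k M x a) = pa k M (M.actG x a)⁻¹ (M.actF x a)⁻¹ := by
  rw [antipodeMap, lift_pa]

noncomputable instance : HopfAlgebra k (Bismash k M) where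
  antipode := antipodeMap k M
  mul_antipode_rTensor_comul := by
    classical
    refine hom_ext fun x a => ?_
    simp only [LinearMap.comp_apply, comul_pa, map_sum, LinearMap.rTensor_tmul,
      LinearMap.mul'_apply, antipodeMap_pa, M.actG_mul_inv, M.actF_mul_inv, counit_pa,
      pa_mul_pa, Algebra.linearMap_apply]
    by_cases hx : x = 1
    · subst hx
      simp only [M.actG_one_left, M.actF_one, one_mul, inv_inv,
        M.actG_actG_inv, if_true, inv_mul_cancel, map_one]
      rw [one_def]
      exact Fintype.sum_bijective _ ((Finite.injective_iff_bijective).1 (M.actG_injective a)) _ _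
        fun y => rfl
    · rw [if_neg hx, map_zero]
      refine Finset.sum_eq_zero fun y _ => ?_
      rw [if_neg]
      intro h
      have h2 := M.actG_mul_inv y x a
      rw [mul_inv_rev, inv_inv, ← h2, M.actG_actG_inv] at h
      exact hx (by simpa using h)
  mul_antipode_lTensor_comul := by
    classical
    refine hom_ext fun x a => ?_
    simp only [LinearMap.comp_apply, comul_pa, map_sum, LinearMap.lTensor_tmul,
      LinearMap.mul'_apply, antipodeMap_pa, M.actG_mul_inv, counit_pa,
      pa_mul_pa, Algebra.linearMap_apply]
    by_cases hx : x = 1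
    · subst hx
      simp only [M.actG_one_left, one_mul, if_true, mul_inv_cancel, map_one]
      rw [one_def]
      exact Fintype.sum_equiv (Equiv.inv G) _ _ fun y => rfl
    · rw [if_neg hx, map_zero]
      refine Finset.sum_eq_zero fun y _ => ?_
      rw [if_neg]
      intro h
      refine hx (M.actG_injective a ?_)
      simpa [M.actG_one_left] using h

end Bismash

section Indicator

variable (k : Type u) [Field k] {H : Type*} [Ring H] [HopfAlgebra k H]

/-- `Λ` is a (two-sided) integral of the Hopf algebra `H` with `ε(Λ) = 1`. -/
def IsNormalizedIntegral (Λ : H) : Prop :=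
  Coalgebra.counit (R := k) Λ = 1 ∧
    ∀ h : H, h * Λ = Coalgebra.counit (R := k) h • Λ ∧ Λ * h = Coalgebra.counit (R := k) h • Λ

theorem IsNormalizedIntegral.unique {Λ Λ' : H} (h : IsNormalizedIntegral k Λ)
    (h' : IsNormalizedIntegral k Λ') : Λ = Λ' := by
  have h1 := (h.2 Λ').2
  have h2 := (h'.2 Λ).1
  rw [h'.1, one_smul] at h1
  rw [h.1, one_smul] at h2
  exact h1.symm.trans h2

/-- The second Sweedler power `h^{[2]} = m(Δ(h)) = ∑ h₁ h₂`. -/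
noncomputable def sweedlerSquare (h : H) : H :=
  LinearMap.mul' k H (Coalgebra.comul h)

variable (H) in
open Classical in
/-- The second Frobenius–Schur indicator `ν₂(W) = χ_W(Λ^{[2]})` of an `H`-module `W`, where `Λ` is
the (unique) normalized integral of `H` and `χ_W` is the character (trace of the action) of `W`.
(The value is set to `0` for a Hopf algebra without a normalized integral.) -/
noncomputable def frobeniusSchurIndicator (W : Type*) [AddCommGroup W] [Module k W] [Module H W]
    [IsScalarTower k H W] : k :=
  if hΛ : ∃ Λ : H, IsNormalizedIntegral k Λ then
    LinearMap.trace k W (Algebra.lsmul k k W (sweedlerSquare k hΛ.choose))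
  else 0

theorem frobeniusSchurIndicator_eq {Λ : H} (hΛ : IsNormalizedIntegral k Λ) (W : Type*)
    [AddCommGroup W] [Module k W] [Module H W] [IsScalarTower k H W] :
    frobeniusSchurIndicator k H W =
      LinearMap.trace k W (Algebra.lsmul k k W (sweedlerSquare k Λ)) := by
  have h : ∃ Λ : H, IsNormalizedIntegral k Λ := ⟨Λ, hΛ⟩
  rw [frobeniusSchurIndicator, dif_pos h, h.choose_spec.unique k hΛ]

end Indicator

namespace Bismash

variable (k : Type u) [Field k] {F : Type v} {G : Type w} [Group F] [Group G]
  (M : MatchedPair F G)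

/-- The element `Λ = (1/|F|) ∑ a, p_1 # a` of `k^G # kF`. -/
noncomputable def integral [Fintype F] : Bismash k M :=
  (Fintype.card F : k)⁻¹ • ∑ a : F, pa k M 1 a

theorem isNormalizedIntegral_integral [Fintype F] [Fintype G] [CharZero k] :
    IsNormalizedIntegral k (integral k M) := by
  classical
  refine ⟨?_, fun h => ⟨?_, ?_⟩⟩
  · rw [integral, map_smul, map_sum]
    simp [counit_pa]
  · have key : LinearMap.mulRight k (integral k M) =
        (Coalgebra.counit (R := k) (A := Bismash k M)).smulRight (integral k M) := by
      refine hom_ext fun x a => ?_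
      rw [LinearMap.mulRight_apply, LinearMap.smulRight_apply, counit_pa, integral,
        mul_smul_comm, Finset.mul_sum]
      simp only [pa_mul_pa]
      by_cases hx : x = 1
      · subst hx
        simp only [M.actG_one_left, if_true, one_smul]
        congr 1
        exact Fintype.sum_equiv (Equiv.mulLeft a) _ _ fun b => rfl
      · have : M.actG x a ≠ 1 := fun h => hx (M.actG_injective a (by simpa [M.actG_one_left]))
        simp [this, hx]
    exact congrArg (fun T => T h) key
  · have key : LinearMap.mulLeft k (integral k M) =
        (Coalgebra.counit (R := k) (A := Bismash k M)).smulRight (integral k M) := by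
      refine hom_ext fun x a => ?_
      rw [LinearMap.mulLeft_apply, LinearMap.smulRight_apply, counit_pa, integral,
        smul_mul_assoc, Finset.sum_mul]
      simp only [pa_mul_pa, M.actG_one_left]
      by_cases hx : x = 1
      · subst hx
        simp only [if_true, one_smul]
        congr 1
        exact Fintype.sum_equiv (Equiv.mulRight a) _ _ fun b => rfl
      · simp [Ne.symm hx, hx]
    exact congrArg (fun T => T h) key

variable {k M}
variable {x : G} {V : Type*} [AddCommGroup V] [Module k V]

/-- The induced module `V̂ = kF ⊗_{kF_x} V` of a representation `(V, ρ)` of the stabilizer `F_x`.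
Mathlib's model of it is the space of `F_x`-coinvariants of `kF ⊗_k V` for the action
`h · (c ⊗ v) = hc ⊗ hv`; the element `b ⊗ v` of `kF ⊗_{kF_x} V` is the class of `b⁻¹ ⊗ v`. -/
def InducedModule (ρ : Representation k (M.stabilizer x) V) :=
  Representation.IndV (M.stabilizer x).subtype ρ

namespace InducedModule

variable (ρ : Representation k (M.stabilizer x) V)

noncomputable instance : AddCommGroup (InducedModule ρ) :=
  inferInstanceAs (AddCommGroup (Representation.IndV (M.stabilizer x).subtype ρ))

noncomputable instance : Module k (InducedModule ρ) :=
  inferInstanceAs (Module k (Representation.IndV (M.stabilizer x).subtype ρ))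

/-- The element `b ⊗ v` of `kF ⊗_{kF_x} V`, linear in `v`. -/
noncomputable def tmul (b : F) : V →ₗ[k] InducedModule ρ :=
  Representation.IndV.mk (M.stabilizer x).subtype ρ b⁻¹

/-- The tensor product is balanced over `kF_x`: `bh ⊗ v = b ⊗ hv`. -/
theorem tmul_mul (b : F) (h : M.stabilizer x) (v : V) :
    tmul ρ (b * h) v = tmul ρ b (ρ h v) := by
  have := Representation.Coinvariants.mk_self_apply
    (Representation.tprod ((Representation.leftRegular k F).comp (M.stabilizer x).subtype) ρ) h
    (MonoidAlgebra.single ((b * h)⁻¹) (1 : k) ⊗ₜ[k] v)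
  refine this.symm.trans ?_
  rw [Representation.tprod_apply, TensorProduct.map_tmul]
  simp [tmul]
  rfl

variable {ρ} in
theorem hom_ext {W : Type*} [AddCommGroup W] [Module k W] {f g : InducedModule ρ →ₗ[k] W}
    (h : ∀ b v, f (tmul ρ b v) = g (tmul ρ b v)) : f = g := by
  refine Representation.IndV.hom_ext (M.stabilizer x).subtype ρ fun c => LinearMap.ext fun v => ?_
  have := h c⁻¹ v
  rw [tmul, inv_inv] at this
  exact this

open Classical in
/-- The linear map `c ↦ δ_{y ◁ (a c⁻¹), x} c a⁻¹` on `kF`; written in terms of `b = c⁻¹` it is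
`b ↦ δ_{y ◁ (ab), x} ab`. -/
noncomputable def actKF (k : Type u) [Field k] {F : Type v} {G : Type w} [Group F] [Group G]
    (M : MatchedPair F G) (x y : G) (a : F) : k[F] →ₗ[k] k[F] :=
  (MonoidAlgebra.basis F k).constr k fun c : F =>
    if M.actG y (a * c⁻¹) = x then MonoidAlgebra.single (c * a⁻¹) (1 : k) else 0

open Classical in
theorem actKF_single (y : G) (a c : F) :
    actKF k M x y a (MonoidAlgebra.single c 1) =
      if M.actG y (a * c⁻¹) = x then MonoidAlgebra.single (c * a⁻¹) (1 : k) else 0 := by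
  rw [← MonoidAlgebra.basis_apply, actKF, Module.Basis.constr_basis]

/-- The operator of `p_y # a` on `kF ⊗_{kF_x} V`: `b ⊗ v ↦ δ_{y ◁ (ab), x} (ab ⊗ v)`. -/
noncomputable def act (y : G) (a : F) : InducedModule ρ →ₗ[k] InducedModule ρ :=
  Representation.Coinvariants.map _ _
    ⟨(actKF k M x y a).rTensor V, fun h => by
      classical
      refine TensorProduct.ext (MonoidAlgebra.lhom_ext' fun c => LinearMap.ext_ring
        (LinearMap.ext fun v => ?_))
      have hx : M.actG x (h : F) = x := h.2
      have hiff : M.actG y (a * (c⁻¹ * (h : F)⁻¹)) = x ↔ M.actG y (a * c⁻¹) = x := by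
        rw [← mul_assoc, M.actG_mul y (a * c⁻¹),
          @eq_comm _ _ x, M.eq_actG_inv_iff, hx,
          eq_comm]
      by_cases hc : M.actG y (a * c⁻¹) = x
      · simp [actKF_single, hc, hiff, mul_assoc]
      · simp [actKF_single, hc, hiff]⟩

open Classical in
theorem act_tmul (y : G) (a b : F) (v : V) :
    act ρ y a (tmul ρ b v) = if M.actG y (a * b) = x then tmul ρ (a * b) v else 0 := by
  have h : act ρ y a (tmul ρ b v) = Representation.Coinvariants.mk _
      (actKF k M x y a (MonoidAlgebra.single b⁻¹ 1) ⊗ₜ[k] v) := rfl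
  rw [h, actKF_single, inv_inv]
  split_ifs
  · rw [tmul, mul_inv_rev]
    rfl
  · rw [TensorProduct.zero_tmul]
    exact map_zero _

variable [Fintype G]

/-- The action of `H = k^G # kF` on `kF ⊗_{kF_x} V`. -/
noncomputable def actHom : Bismash k M →ₐ[k] Module.End k (InducedModule ρ) :=
  AlgHom.ofLinearMap (lift k M (act ρ))
    (by
      classical
      refine hom_ext fun b v => ?_
      rw [one_def, map_sum, LinearMap.sum_apply]
      simp only [lift_pa, act_tmul, one_mul]
      rw [Finset.sum_eq_single (M.actG x b⁻¹)]
      · rw [if_pos (M.actG_inv_actG x b)]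
        rfl
      · intro y _ hy
        rw [if_neg fun h => hy ((M.eq_actG_inv_iff y x b).2 h)]
      · simp)
    (fun f g => by
      classical
      have key : (LinearMap.mul k (Bismash k M)).compr₂ (lift k M (act ρ)) =
          (LinearMap.mul k (Module.End k (InducedModule ρ))).compl₁₂
            (lift k M (act ρ)) (lift k M (act ρ)) := by
        refine Bismash.hom_ext fun y a => Bismash.hom_ext fun z b => hom_ext fun c v => ?_
        change lift k M (act ρ) (pa k M y a * pa k M z b) (tmul ρ c v) =
          lift k M (act ρ) (pa k M y a) (lift k M (act ρ) (pa k M z b) (tmul ρ c v))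
        rw [pa_mul_pa, lift_pa, lift_pa, act_tmul]
        by_cases h : M.actG y a = z
        · subst h
          rw [if_pos rfl, lift_pa, act_tmul, mul_assoc, M.actG_mul y a]
          split_ifs with h2
          · rw [act_tmul, M.actG_mul y a, if_pos h2]
          · rw [map_zero]
        · rw [if_neg h, map_zero, LinearMap.zero_apply]
          split_ifs with h2
          · rw [act_tmul, M.actG_mul y a, if_neg]
            intro h3
            exact h (M.actG_injective (b * c) (h3.trans h2.symm))
          · rw [map_zero]
      exact congrArg (fun T => T f g) key)

noncomputable instance : Module (Bismash k M) (InducedModule ρ) :=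
  Module.compHom _ (actHom ρ).toRingHom

theorem smul_def (f : Bismash k M) (w : InducedModule ρ) : f • w = actHom ρ f w := rfl

instance : IsScalarTower k (Bismash k M) (InducedModule ρ) :=
  ⟨fun r f w => by rw [smul_def, smul_def, map_smul, LinearMap.smul_apply]⟩

open Classical in
/-- The defining formula `(p_y # a)(b ⊗ v) = δ_{y ◁ (ab), x} (ab ⊗ v)`. -/
theorem pa_smul_tmul (y : G) (a b : F) (v : V) :
    pa k M y a • tmul ρ b v = if M.actG y (a * b) = x then tmul ρ (a * b) v else 0 := by
  rw [smul_def]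
  change lift k M (act ρ) (pa k M y a) (tmul ρ b v) = _
  rw [lift_pa, act_tmul]

end InducedModule

end Bismash

/-- The orbit `O_x` is a null indicator orbit: for every irreducible representation `V` of the
stabilizer `F_x`, the induced module `V̂ = kF ⊗_{kF_x} V` of `H = k^G # kF` has Frobenius–Schur
indicator `0`. -/
def IsNullIndicatorOrbit (k : Type u) [Field k] {F : Type v} {G : Type w} [Group F] [Group G]
    [Fintype G] (M : MatchedPair F G) (x : G) : Prop :=
  ∀ (V : Type u) [AddCommGroup V] [Module k V] (ρ : Representation k (M.stabilizer x) V),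
    ρ.IsIrreducible →
      frobeniusSchurIndicator k (Bismash k M) (Bismash.InducedModule ρ) = 0

/-! With the integral `Λ = |F|⁻¹ ∑ₐ p_1 # a`, the square `Λ^{[2]}` is `|F|⁻¹` times the sum of
`p_{y⁻¹} # (y ▷ a)a` over the pairs `(a, y)` with `y ◁ a = y⁻¹`. On a module induced from `F_x`, an
element `p_z # b` acts by zero unless `z ∈ O_x` (`act_eq_zero`). A surviving pair therefore puts
both `y⁻¹` and `y = y⁻¹ ◁ a⁻¹` in `O_x`. If `x⁻¹ ∉ O_x` there is no such pair and every indicator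
vanishes.

If `x⁻¹ ∈ O_x`, take `V` trivial. The induced module then has a basis indexed by `O_x`, and each
surviving term acts as an idempotent of rank one (`trace_act_trivial`), because `(y ▷ a)a` fixes
`y⁻¹`. The indicator is `|F|⁻¹` times the number of surviving pairs, which is nonzero in
characteristic `0`: some pair `(a, x)` is counted.

The three conditions on inverses agree because inversion permutes orbits, by `(x ◁ a)⁻¹ = x⁻¹ ◁ (x ▷
a)`. -/

namespace MatchedPair

/-! ### Orbits and inversion. -/

variable {F : Type v} {G : Type w} [Group F] [Group G] (M : MatchedPair F G)

/-- The quotient rule `actG_mul_inv` with numerator `1`, which `a` fixes. Inversion thus respects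
`◁` up to twisting the acting element by `x ▷ _`. -/
theorem inv_actG (x : G) (a : F) : (M.actG x a)⁻¹ = M.actG x⁻¹ (M.actF x a) := by
  simpa [M.actG_one_left] using (M.actG_mul_inv 1 x a).symm

theorem mem_orbit_self (x : G) : x ∈ M.orbit x := ⟨1, M.actG_one x⟩

variable {M} in
theorem actG_mem_orbit {x y : G} (hy : y ∈ M.orbit x) (a : F) : M.actG y a ∈ M.orbit x := by
  obtain ⟨b, rfl⟩ := hy
  exact ⟨b * a, M.actG_mul x b a⟩

variable {M} in
theorem mem_orbit_symm {x y : G} (hy : y ∈ M.orbit x) : x ∈ M.orbit y := by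
  obtain ⟨b, rfl⟩ := hy
  exact ⟨b⁻¹, M.actG_actG_inv x b⟩

variable {M} in
/-- Inversion carries `O_x` into `O_{x⁻¹}`. -/
theorem inv_mem_orbit_inv {x y : G} (hy : y ∈ M.orbit x) : y⁻¹ ∈ M.orbit x⁻¹ := by
  obtain ⟨b, rfl⟩ := hy
  exact ⟨M.actF x b, (M.inv_actG x b).symm⟩

-- The elements `x⁻¹` and `y⁻¹` share an orbit, and `O_x` is stable under `◁`.
variable {M} in
theorem inv_mem_orbit_iff {x y : G} (hy : y ∈ M.orbit x) :
    y⁻¹ ∈ M.orbit x ↔ x⁻¹ ∈ M.orbit x := by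
  constructor
  · intro h
    obtain ⟨b, hb⟩ := mem_orbit_symm (inv_mem_orbit_inv hy)
    exact hb ▸ actG_mem_orbit h b
  · intro h
    obtain ⟨b, hb⟩ := inv_mem_orbit_inv hy
    exact hb ▸ actG_mem_orbit h b

end MatchedPair

/-! ### The Sweedler square of the integral and its trace on induced modules. -/

namespace Bismash

variable (k : Type u) [Field k] {F : Type v} {G : Type w} [Group F] [Group G]
  (M : MatchedPair F G)

open Classical in
/-- `(p_1 # a)^{[2]}` is the sum of the `p_{y⁻¹} # (y ▷ a)a` over the `y` with `y ◁ a = y⁻¹`. -/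
theorem sweedlerSquare_pa_one [Fintype G] (a : F) :
    sweedlerSquare k (pa k M 1 a) =
      ∑ y : G, if M.actG y a = y⁻¹ then pa k M y⁻¹ (M.actF y a * a) else 0 := by
  rw [sweedlerSquare, comul_pa, map_sum]
  refine Finset.sum_congr rfl fun y _ => ?_
  -- The product `(p_{y⁻¹} # (y ▷ a))(p_y # a)` survives exactly when `y⁻¹ ◁ (y ▷ a) = y`, and the
  -- left side is `(y ◁ a)⁻¹`.
  rw [LinearMap.mul'_apply, pa_mul_pa, one_mul, ← M.inv_actG]
  simp only [inv_eq_iff_eq_inv]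

open Classical in
theorem sweedlerSquare_integral [Fintype F] [Fintype G] :
    sweedlerSquare k (integral k M) = (Fintype.card F : k)⁻¹ •
      ∑ a : F, ∑ y : G, if M.actG y a = y⁻¹ then pa k M y⁻¹ (M.actF y a * a) else 0 := by
  simp only [← sweedlerSquare_pa_one]
  simp only [sweedlerSquare, integral, map_smul, map_sum]

variable {k M}

namespace InducedModule

variable {x : G} {V : Type*} [AddCommGroup V] [Module k V]
  (ρ : Representation k (M.stabilizer x) V)

instance [Finite F] [Module.Finite k V] : Module.Finite k (InducedModule ρ) :=
  inferInstanceAs (Module.Finite k (Representation.Coinvariants _))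

/-- A vector `b ⊗ v` survives only if `y ◁ (ab) = x`, which would place `x` and `y` in one orbit. -/
theorem act_eq_zero {y : G} (hy : y ∉ M.orbit x) (a : F) : act ρ y a = 0 := by
  refine hom_ext fun b v => ?_
  rw [act_tmul, if_neg, LinearMap.zero_apply]
  rintro rfl
  exact hy (MatchedPair.mem_orbit_symm ⟨_, rfl⟩)

-- Only linearity of the trace enters, so `V` may have any dimension.
open Classical in
theorem frobeniusSchurIndicator_eq_sum [Fintype F] [Fintype G] [CharZero k] :
    frobeniusSchurIndicator k (Bismash k M) (InducedModule ρ) = (Fintype.card F : k)⁻¹ *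
      ∑ a : F, ∑ y : G, if M.actG y a = y⁻¹ then
        LinearMap.trace k _ (act ρ y⁻¹ (M.actF y a * a)) else 0 := by
  have hact : ∀ f, Algebra.lsmul k k (InducedModule ρ) f = lift k M (act ρ) f := fun f => rfl
  rw [frobeniusSchurIndicator_eq k (isNormalizedIntegral_integral k M), sweedlerSquare_integral,
    hact, map_smul, map_smul, smul_eq_mul]
  simp only [map_sum, apply_ite (lift k M (act ρ)), apply_ite (LinearMap.trace k _), lift_pa,
    map_zero]

variable (k M x) in
open Classical in
/-- For the trivial representation, the coefficient of `w` at the orbit point `z = x ◁ b⁻¹` in the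
basis of the elements `b ⊗ 1`. -/
noncomputable def trivialCoord (z : G) :
    InducedModule (Representation.trivial k (M.stabilizer x) k) →ₗ[k] k :=
  Representation.Coinvariants.lift _
    (TensorProduct.lid k k ∘ₗ ((MonoidAlgebra.basis F k).constr k fun c : F =>
      if M.actG x c = z then (1 : k) else 0).rTensor k) fun h => by
    -- The functional descends to coinvariants because `x ◁ (hc) = x ◁ c` for `h ∈ F_x`.
    have hx : M.actG x (h : F) = x := h.2
    refine TensorProduct.ext (MonoidAlgebra.lhom_ext' fun c => LinearMap.ext_ring
      (LinearMap.ext fun v => ?_))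
    have hv (d : F) : ((MonoidAlgebra.basis F k).constr k fun c : F =>
        if M.actG x c = z then (1 : k) else 0) (MonoidAlgebra.single d 1) =
          if M.actG x d = z then 1 else 0 := by
      rw [← MonoidAlgebra.basis_apply, Module.Basis.constr_basis]
    simp [hv, M.actG_mul, hx]

open Classical in
theorem trivialCoord_tmul (z : G) (b : F) (v : k) :
    trivialCoord k M x z (tmul _ b v) = if M.actG x b⁻¹ = z then v else 0 := by
  have h : trivialCoord k M x z (tmul _ b v) = TensorProduct.lid k k
      (((MonoidAlgebra.basis F k).constr k fun c : F =>
        if M.actG x c = z then (1 : k) else 0) (MonoidAlgebra.single b⁻¹ 1) ⊗ₜ[k] v) := rfl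
  rw [h, ← MonoidAlgebra.basis_apply, Module.Basis.constr_basis]
  simp

/-- The hypothesis says `c⁻¹b ∈ F_x`, and this element moves across the tensor sign, where it acts
trivially. So `b ⊗ v` depends on `b` only through the orbit point `x ◁ b⁻¹`. -/
theorem trivial_tmul_eq {b c : F} (h : M.actG x b⁻¹ = M.actG x c⁻¹) (v : k) :
    tmul (Representation.trivial k (M.stabilizer x) k) b v = tmul _ c v := by
  have hs : M.actG x (c⁻¹ * b) = x := by
    rw [M.actG_mul, ← h, M.actG_inv_actG]
  have := tmul_mul (Representation.trivial k (M.stabilizer x) k) c ⟨c⁻¹ * b, hs⟩ v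
  simpa using this

/-- If `z ∈ O_x` and `z ◁ a = z`, then `p_z # a` acts on the module induced from the trivial
representation as an idempotent of rank one. -/
theorem trace_act_trivial [Finite F] {z : G} (hz : z ∈ M.orbit x) {a : F} (ha : M.actG z a = z) :
    LinearMap.trace k _ (act (Representation.trivial k (M.stabilizer x) k) z a) = 1 := by
  obtain ⟨c, rfl⟩ := hz
  change M.actG (M.actG x c) a = M.actG x c at ha
  -- The vector `c⁻¹ ⊗ 1` sits at the point `z = x ◁ c`. Since `a` fixes `z`, the operator reads off
  -- the coordinate at `z` and multiplies this vector by it; its trace is the coordinate at `z` of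
  -- the vector itself.
  have key : act (Representation.trivial k (M.stabilizer x) k) (M.actG x c) a =
      (trivialCoord k M x (M.actG x c)).smulRight (tmul _ c⁻¹ 1) := by
    refine hom_ext fun b v => ?_
    rw [act_tmul, LinearMap.smulRight_apply, trivialCoord_tmul]
    have hiff : M.actG (M.actG x c) (a * b) = x ↔ M.actG x b⁻¹ = M.actG x c := by
      rw [M.actG_mul _ a, ha, ← M.eq_actG_inv_iff, eq_comm]
    by_cases h : M.actG x b⁻¹ = M.actG x c
    · rw [if_pos (hiff.2 h), if_pos h, ← map_smul, smul_eq_mul, mul_one]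
      refine trivial_tmul_eq ?_ v
      rw [inv_inv, mul_inv_rev, M.actG_mul, h, eq_comm, M.eq_actG_inv_iff, ha]
    · rw [if_neg (mt hiff.1 h), if_neg h, zero_smul]
  rw [key, LinearMap.trace_smulRight, trivialCoord_tmul, inv_inv, if_pos rfl]

end InducedModule

end Bismash

theorem Representation.isIrreducible_trivial (k G : Type*) [Field k] [Group G] :
    (Representation.trivial k G k).IsIrreducible where
  exists_pair_ne := ⟨⊥, ⊤, fun h =>
    bot_ne_top (α := Submodule k k) (congrArg Subrepresentation.toSubmodule h)⟩
  eq_bot_or_eq_top σ := (eq_bot_or_eq_top σ.toSubmodule).imp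
    (fun h => Subrepresentation.toSubmodule_injective h)
    (fun h => Subrepresentation.toSubmodule_injective h)

/-! ### Null indicator orbits. -/

section NullIndicator

variable {k : Type u} [Field k] [CharZero k] {F : Type v} {G : Type w} [Group F] [Group G]
  [Fintype F] [Fintype G] {M : MatchedPair F G} {x : G}

open Bismash InducedModule

theorem isNullIndicatorOrbit_of_inv_notMem (hx : x⁻¹ ∉ M.orbit x) :
    IsNullIndicatorOrbit k M x := by
  classical
  intro V _ _ ρ _
  rw [frobeniusSchurIndicator_eq_sum]
  convert mul_zero _
  refine Finset.sum_eq_zero fun a _ => Finset.sum_eq_zero fun y _ => ?_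
  split_ifs with h
  · rw [act_eq_zero, map_zero]
    -- Here `y ◁ a = y⁻¹` lies in `O_x`, hence so does `y`; then `O_x` contains a point together
    -- with its inverse.
    intro hy
    rw [← h] at hy
    have hy' : y ∈ M.orbit x := by
      simpa only [M.actG_actG_inv] using MatchedPair.actG_mem_orbit hy a⁻¹
    exact hx ((MatchedPair.inv_mem_orbit_iff hy').1 (h ▸ hy))
  · rfl

/-- Up to the factor `|F|⁻¹`, the indicator counts the pairs `(a, y)` with `y ◁ a = y⁻¹ ∈ O_x`. -/
theorem frobeniusSchurIndicator_trivial_ne_zero (hx : x⁻¹ ∈ M.orbit x) :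
    frobeniusSchurIndicator k (Bismash k M)
      (InducedModule (Representation.trivial k (M.stabilizer x) k)) ≠ 0 := by
  classical
  rw [frobeniusSchurIndicator_eq_sum]
  refine mul_ne_zero (inv_ne_zero (Nat.cast_ne_zero.2 Fintype.card_ne_zero)) ?_
  -- Terms are written as casts from `ℕ`, where a sum vanishes only if every summand does.
  have hterm : ∀ (a : F) (y : G), (if M.actG y a = y⁻¹ then LinearMap.trace k _
      (act (Representation.trivial k (M.stabilizer x) k) y⁻¹ (M.actF y a * a)) else 0) =
      (((if M.actG y a = y⁻¹ ∧ y⁻¹ ∈ M.orbit x then 1 else 0 : ℕ)) : k) := by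
    intro a y
    by_cases h : M.actG y a = y⁻¹
    · by_cases hy : y⁻¹ ∈ M.orbit x
      · rw [if_pos h, if_pos ⟨h, hy⟩, trace_act_trivial hy, Nat.cast_one]
        -- `y⁻¹ ◁ (y ▷ a)a = (y ◁ a)⁻¹ ◁ a = y ◁ a = y⁻¹`.
        rw [M.actG_mul, ← M.inv_actG, h, inv_inv, h]
      · rw [if_pos h, if_neg fun h' => hy h'.2, act_eq_zero _ hy, map_zero, Nat.cast_zero]
    · rw [if_neg h, if_neg fun h' => h h'.1, Nat.cast_zero]
  simp only [hterm]
  obtain ⟨a, ha⟩ := id hx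
  norm_cast
  intro h0
  -- The summand at `(a, x)`, with `x ◁ a = x⁻¹`, equals `1`.
  have := Finset.sum_eq_zero_iff.1 (Finset.sum_eq_zero_iff.1 h0 a (Finset.mem_univ a)) x
    (Finset.mem_univ x)
  exact one_ne_zero ((if_pos ⟨ha, hx⟩).symm.trans this)

theorem isNullIndicatorOrbit_iff : IsNullIndicatorOrbit k M x ↔ x⁻¹ ∉ M.orbit x :=
  ⟨fun h hx => frobeniusSchurIndicator_trivial_ne_zero hx
    (h k _ (Representation.isIrreducible_trivial k _)), isNullIndicatorOrbit_of_inv_notMem⟩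

end NullIndicator

theorem mainTheorem3 {k : Type u} [Field k] [IsAlgClosed k] [CharZero k]
    {F : Type v} {G : Type w} [Group F] [Group G] [Fintype F] [Fintype G]
    (M : MatchedPair F G) (x : G) :
    [IsNullIndicatorOrbit k M x,
      x⁻¹ ∉ M.orbit x,
      ∃ y ∈ M.orbit x, y⁻¹ ∉ M.orbit x,
      ∀ y ∈ M.orbit x, y⁻¹ ∉ M.orbit x].TFAE := by
  tfae_have 1 ↔ 2 := isNullIndicatorOrbit_iff
  tfae_have 2 → 4 := fun h y hy hy' => h ((MatchedPair.inv_mem_orbit_iff hy).1 hy')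
  tfae_have 4 → 3 := fun h => ⟨x, M.mem_orbit_self x, h x (M.mem_orbit_self x)⟩
  tfae_have 3 → 2 := fun ⟨y, hy, hy'⟩ h => hy' ((MatchedPair.inv_mem_orbit_iff hy).2 h)
  tfae_finish
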